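/- Let $q$ be a prime power, let $\mathrm{AG}(2,q)$ be the Desarguesian affine plane of order $q$ (points: the elements of $\mathbb{F}_q^2$; lines: the one-dimensional affine subspaces), and let $\mathrm{BG}(2,q)$ be the Desarguesian biaffine plane, obtained from $\mathrm{AG}(2,q)$ by removing the lines of one parallel class (keeping all points). Its incidence graph is the bipartite graph whose vertices are the points and lines of $\mathrm{BG}(2,q)$, a point and a line being adjacent if and only if they are incident. The metric dimension of a finite connected graph $G$ is the smallest size of a set $S$ of vertices such that any two distinct vertices of $G$ have different distances to some element of $S$. Then the metric dimension of the incidence graph of $\mathrm{BG}(2,q)$ is at least $\frac{8q}{3}-7$. -/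

import Mathlib

/-- The incidence graph of a point-line incidence relation: the bipartite graph whose vertices are
the points and the lines, a point being adjacent to a line exactly when they are incident. -/
def incidenceGraph {P L : Type*} (I : P → L → Prop) : SimpleGraph (P ⊕ L) where
  Adj
    | Sum.inl p, Sum.inr l => I p l
    | Sum.inr l, Sum.inl p => I p l
    | _, _ => False
  symm := ⟨by rintro (p | l) (p' | l') h <;> exact h⟩
  loopless := ⟨by rintro (p | l) h <;> exact h⟩

/-- `S` is a resolving set for the (connected) graph `G` if every vertex is determined by its list
of distances from the members of `S`. -/
def IsResolvingSet {V : Type*} (G : SimpleGraph V) (S : Finset V) : Prop :=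
  ∀ u v : V, (∀ s ∈ S, G.dist u s = G.dist v s) → u = v

/-- The metric dimension of a finite (connected) graph: the size of a smallest resolving set. The
set of all vertices is always resolving, so the infimum is attained for a finite vertex set. -/
noncomputable def metricDimension {V : Type*} (G : SimpleGraph V) : ℕ :=
  sInf {n : ℕ | ∃ S : Finset V, IsResolvingSet G S ∧ S.card = n}

/-- The lines of the Desarguesian affine plane `AG(2, F)`, whose points are the elements of
`F × F`: the one-dimensional affine subspaces. -/
abbrev AffineLine (F : Type*) [Field F] : Type _ :=
  {l : AffineSubspace F (F × F) // Module.finrank F l.direction = 1}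

/-- The lines of the Desarguesian biaffine plane obtained from `AG(2, F)` by removing the parallel
class of the line `m`; the points remain all the elements of `F × F`. -/
abbrev BiaffineLine {F : Type*} [Field F] (m : AffineLine F) : Type _ :=
  {l : AffineLine F // ¬ l.1.Parallel m.1}

/-- The incidence graph of the Desarguesian biaffine plane obtained from `AG(2, F)` by removing the
parallel class of the line `m`. -/
def biaffineGraph {F : Type*} [Field F] (m : AffineLine F) :
    SimpleGraph ((F × F) ⊕ BiaffineLine m) :=
  incidenceGraph fun (p : F × F) (l : BiaffineLine m) => p ∈ l.1.1

/-! Let a point (x, y) lie on a line (a, b) when xa = y + b. In these coordinates the biaffine plane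
is self-dual and the removed class is vertical. A line is at distance 1 or 3 from a point and 0, 2
or 4 from a line, according to incidence, equality and parallelism. Hence the points P and lines L
of a resolving set satisfy `ResolvesLines P L` and, dually, `ResolvesLines L P`. Put p = |P|, t =
|L|; by duality p ≤ t may be assumed.

Call a line skew if it misses P. At most one skew line of each slope is outside L
(`ResolvesLines.card_skew_le`), so at most t + q non-vertical lines are skew. The index s of a point
at infinity counts the skew lines through it, with the line at infinity included. The Szőnyi–Weiner
inequality `card_mul_le_of_pencil`, used in the dual plane, gives s(2q - p + 1 - s) ≤ D, where D is
the number of all skew lines, infinity included.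

Suppose 3(p + t) + 22 ≤ 8q. Then D is too small for 4 ≤ s ≤ 2q - p - 3 (`index_lt_or_gt`), and
larger s would need too many points or lines, so every index is at most 3. If s is the largest
index, then D ≤ s + q(s - 1), and the inequality becomes (s + 1)q ≤ sp + s². The critical case s = 3
gives 3p ≥ 4q - 9, whence p + t ≥ 2p ≥ 8q/3 - 6, a contradiction. -/

open Polynomial in
/-- The restriction to the vertical line with abscissa `x` of the polynomial
`∏ (1 + p.1 * X + p.2 * Y)`, as a polynomial in `Y`. -/
noncomputable def pencilPoly {F : Type*} [Field F] (T : Finset (F × F)) (x : F) : F[X] :=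
  ∏ p ∈ T, (C (1 + p.1 * x) + C p.2 * X)

/-! ### The Szőnyi–Weiner inequality via Hankel determinants -/

section PencilPoly

open Polynomial Finset

variable {F : Type*} [Field F]

lemma eval_pencilPoly (T : Finset (F × F)) (x y : F) :
    (pencilPoly T x).eval y = ∏ p ∈ T, (1 + p.1 * x + p.2 * y) := by
  simp [pencilPoly, eval_prod]

variable [Fintype F]

/-- As a function of x, the coefficient of Y^j is a polynomial of degree at most |T| - j, and the
power sums over F with exponent below q - 1 vanish. -/
lemma sum_pow_mul_coeff_pencilPoly (T : Finset (F × F)) (c j : ℕ)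
    (h : c + T.card < Fintype.card F - 1 + j) :
    ∑ x : F, x ^ c * (pencilPoly T x).coeff j = 0 := by
  classical
  induction T using Finset.induction_on generalizing c j with
  | empty =>
    rcases Nat.eq_zero_or_pos j with rfl | hj
    · simpa [pencilPoly] using FiniteField.sum_pow_lt_card_sub_one F c (by simpa using h)
    · simp [pencilPoly, coeff_one, hj.ne']
  | insert p T hp ih =>
    rw [card_insert_of_notMem hp] at h
    have hprod : ∀ x : F, pencilPoly (insert p T) x
        = C (1 + p.1 * x) * pencilPoly T x + C p.2 * (X * pencilPoly T x) := by
      intro x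
      rw [pencilPoly, prod_insert hp, pencilPoly]
      ring
    have h1 := ih c j (by omega)
    have h2 := ih (c + 1) j (by omega)
    have h3 : ∑ x : F, x ^ c * (X * pencilPoly T x).coeff j = 0 := by
      cases j with
      | zero => simp
      | succ j => simpa using ih c j (by omega)
    calc ∑ x : F, x ^ c * (pencilPoly (insert p T) x).coeff j
        = ∑ x : F, x ^ c * (pencilPoly T x).coeff j
          + p.1 * ∑ x : F, x ^ (c + 1) * (pencilPoly T x).coeff j
          + p.2 * ∑ x : F, x ^ c * (X * pencilPoly T x).coeff j := by
          rw [mul_sum, mul_sum, ← sum_add_distrib, ← sum_add_distrib]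
          refine sum_congr rfl fun x _ => ?_
          rw [hprod, coeff_add, coeff_C_mul, coeff_C_mul]
          ring
      _ = 0 := by rw [h1, h2, h3]; ring

/-- The Hankel matrix of power moments of `x ↦ pencilPoly T x`. -/
noncomputable def pencilHankel (T : Finset (F × F)) (s : ℕ) : Matrix (Fin s) (Fin s) F[X] :=
  Matrix.of fun a b => ∑ x : F, C (x ^ (a : ℕ)) * pencilPoly T x * C (x ^ (b : ℕ))

lemma natDegree_pencilHankel_le (T : Finset (F × F)) (s : ℕ) (a b : Fin s)
    (h : pencilHankel T s a b ≠ 0) :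
    (pencilHankel T s a b).natDegree + (Fintype.card F - 1) ≤ T.card + a + b := by
  by_contra! hlt
  apply h
  rw [← leadingCoeff_eq_zero, leadingCoeff]
  rw [← sum_pow_mul_coeff_pencilPoly T (a + b) (pencilHankel T s a b).natDegree (by omega)]
  generalize (pencilHankel T s a b).natDegree = j
  simp only [pencilHankel, Matrix.of_apply, finsetSum_coeff, coeff_mul_C, coeff_C_mul]
  refine sum_congr rfl fun x _ => ?_
  ring

/-- In every Leibniz term the row indices and the column indices each sum to s(s - 1)/2, so the
entrywise bounds add up to s(|T| - (q - 1)) + s(s - 1). -/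
lemma natDegree_det_pencilHankel_le (T : Finset (F × F)) (s : ℕ)
    (h : (pencilHankel T s).det ≠ 0) :
    (pencilHankel T s).det.natDegree + s * Fintype.card F ≤ s * T.card + s * s := by
  classical
  set d := (pencilHankel T s).det.natDegree with hd
  have hc : (pencilHankel T s).det.coeff d ≠ 0 := by
    rw [hd]; exact leadingCoeff_ne_zero.2 h
  rw [Matrix.det_apply, finsetSum_coeff] at hc
  obtain ⟨σ, -, hσ⟩ := exists_ne_zero_of_sum_ne_zero hc
  have hσ' : (∏ i, pencilHankel T s (σ i) i).coeff d ≠ 0 := by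
    intro h0
    apply hσ
    rw [coeff_smul, h0, smul_zero]
  have hne : ∏ i, pencilHankel T s (σ i) i ≠ 0 := by
    intro h0; simp [h0] at hσ'
  have hle : d ≤ ∑ i, (pencilHankel T s (σ i) i).natDegree :=
    (le_natDegree_of_ne_zero hσ').trans (natDegree_prod_le _ _)
  have hsum : ∑ i : Fin s, ((pencilHankel T s (σ i) i).natDegree + (Fintype.card F - 1))
      ≤ ∑ i : Fin s, (T.card + (σ i : ℕ) + i) :=
    sum_le_sum fun i _ => natDegree_pencilHankel_le T s _ _ (prod_ne_zero_iff.1 hne i (mem_univ i))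
  have hperm : ∑ i : Fin s, (σ i : ℕ) = ∑ i : Fin s, (i : ℕ) := Equiv.sum_comp σ _
  have hgauss : (∑ i : Fin s, (i : ℕ)) * 2 = s * (s - 1) := by
    rw [Fin.sum_univ_eq_sum_range fun i => i, sum_range_id_mul_two]
  simp only [sum_add_distrib, sum_const, card_univ, Fintype.card_fin, smul_eq_mul, hperm] at hsum
  have hq : 1 ≤ Fintype.card F := Fintype.card_pos
  obtain ⟨r, hr⟩ := Nat.exists_eq_add_of_le hq
  rw [hr] at hsum ⊢
  cases s with
  | zero => simp at hle ⊢; exact hle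
  | succ s =>
    simp only [Nat.add_sub_cancel_left, Nat.add_sub_cancel] at hsum hgauss
    nlinarith

/-- At Y = y only the s abscissae with a nonzero value contribute. The size s of the matrix is
chosen to make their Vandermonde matrix V square, and the Hankel matrix becomes VᵀDV with D diagonal
and invertible. -/
lemma det_pencilHankel_ne_zero (T : Finset (F × F)) (y : F) [DecidableEq F]
    {s : ℕ} (hs : (univ.filter fun x : F => (pencilPoly T x).eval y ≠ 0).card = s) :
    (pencilHankel T s).det ≠ 0 := by
  set D := univ.filter fun x : F => (pencilPoly T x).eval y ≠ 0 with hD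
  let e : Fin s ≃ D := (D.equivFinOfCardEq hs).symm
  let v : Fin s → F := fun i => (e i : F)
  have hv : Function.Injective v := Subtype.val_injective.comp e.injective
  have hmat : (pencilHankel T s).map (evalRingHom y)
      = (Matrix.vandermonde v).transpose
        * Matrix.diagonal (fun i => (pencilPoly T (v i)).eval y) * Matrix.vandermonde v := by
    ext a b
    rw [Matrix.mul_apply]
    simp only [Matrix.mul_diagonal, Matrix.map_apply, pencilHankel, Matrix.of_apply,
      Matrix.transpose_apply, Matrix.vandermonde_apply, coe_evalRingHom, eval_finsetSum, eval_mul,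
      eval_C]
    rw [← sum_subset (subset_univ D), ← sum_coe_sort D, ← Equiv.sum_comp e]
    intro x _ hx
    have : (pencilPoly T x).eval y = 0 := by simpa [hD] using hx
    simp [this]
  intro h0
  have h1 : ((pencilHankel T s).map (evalRingHom y)).det = 0 := by
    rw [← RingHom.mapMatrix_apply, ← RingHom.map_det, h0, map_zero]
  rw [hmat, Matrix.det_mul, Matrix.det_mul, Matrix.det_transpose, Matrix.det_diagonal] at h1
  have hV : (Matrix.vandermonde v).det ≠ 0 := Matrix.det_vandermonde_ne_zero_iff.2 hv
  have hP : ∏ i, (pencilPoly T (v i)).eval y ≠ 0 :=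
    prod_ne_zero_iff.2 fun i _ => (mem_filter.1 (e i).2).2
  exact mul_ne_zero (mul_ne_zero hV hP) hV h1

/-- Multilinearity in the rows gives one determinant for each choice of an abscissa per row. A
repeated abscissa gives proportional rows. If the abscissae are distinct, all but at most n(y) of
the rows carry a factor vanishing at y, where n(y) counts the abscissae with nonzero value at y. -/
lemma pow_dvd_det_pencilHankel (T : Finset (F × F)) (s : ℕ) (y : F) [DecidableEq F] :
    (X - C y) ^ (s - (univ.filter fun x : F => (pencilPoly T x).eval y ≠ 0).card)
      ∣ (pencilHankel T s).det := by
  have hrow : pencilHankel T s = fun a : Fin s => ∑ x : F, (fun b : Fin s =>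
      (C (x ^ (a : ℕ)) * pencilPoly T x) * C (x ^ (b : ℕ))) := by
    ext a b
    simp [pencilHankel, Finset.sum_apply]
  have hdet : (pencilHankel T s).det = ∑ r : Fin s → F, Matrix.det (Matrix.of fun a b : Fin s =>
      (C (r a ^ (a : ℕ)) * pencilPoly T (r a)) * C (r a ^ (b : ℕ))) := by
    rw [hrow]
    exact (Matrix.detRowAlternating (n := Fin s) (R := F[X])).toMultilinearMap.map_sum
      (fun (a : Fin s) (x : F) (b : Fin s) =>
        (C (x ^ (a : ℕ)) * pencilPoly T x) * C (x ^ (b : ℕ)))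
  rw [hdet]
  refine dvd_sum fun r _ => ?_
  have hmul := Matrix.det_mul_column (fun a => C (r a ^ (a : ℕ)) * pencilPoly T (r a))
    (Matrix.of fun a b => C (r a ^ (b : ℕ)))
  simp only [Matrix.of_apply] at hmul
  rw [hmul]
  by_cases hr : Function.Injective r
  · refine Dvd.dvd.mul_right ?_ _
    rw [prod_mul_distrib]
    refine Dvd.dvd.mul_left ?_ _
    set Z := univ.filter fun a : Fin s => (pencilPoly T (r a)).eval y = 0
    have hcard : s - (univ.filter fun x : F => (pencilPoly T x).eval y ≠ 0).card ≤ Z.card := by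
      have h1 : Z.card + (univ.filter fun a : Fin s => (pencilPoly T (r a)).eval y ≠ 0).card
          = s := by
        simpa using card_filter_add_card_filter_not (s := (univ : Finset (Fin s)))
          (fun a : Fin s => (pencilPoly T (r a)).eval y = 0)
      have h2 : (univ.filter fun a : Fin s => (pencilPoly T (r a)).eval y ≠ 0).card
          ≤ (univ.filter fun x : F => (pencilPoly T x).eval y ≠ 0).card :=
        card_le_card_of_injOn r (by intro a; simp) hr.injOn
      omega
    refine (pow_dvd_pow _ hcard).trans ?_
    refine Dvd.dvd.trans ?_ (prod_dvd_prod_of_subset Z univ _ (subset_univ Z))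
    rw [← prod_const]
    exact prod_dvd_prod_of_dvd _ _ fun a ha => dvd_iff_isRoot.2 (mem_filter.1 ha).2
  · have h0 : (Matrix.of fun a b : Fin s => (C (r a ^ (b : ℕ)) : F[X])).det = 0 := by
      rw [Function.Injective] at hr
      push Not at hr
      obtain ⟨i, j, hij, hne⟩ := hr
      exact Matrix.det_zero_of_row_eq hne (by ext1 b; simp [hij])
    rw [h0, mul_zero]
    exact dvd_zero _

/-- The Szőnyi–Weiner inequality for a product of affine linear forms with constant term `1`. -/
lemma card_mul_le_of_pencil (T : Finset (F × F)) (y : F) [DecidableEq F] {s : ℕ}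
    (hs : (univ.filter fun x : F => ∀ p ∈ T, 1 + p.1 * x + p.2 * y ≠ 0).card = s) :
    2 * (s * Fintype.card F)
      ≤ (univ.filter fun z : F × F => ∀ p ∈ T, 1 + p.1 * z.1 + p.2 * z.2 ≠ 0).card
        + s * T.card + s * s := by
  have hiff : ∀ x y : F, (pencilPoly T x).eval y ≠ 0 ↔ ∀ p ∈ T, 1 + p.1 * x + p.2 * y ≠ 0 := by
    intro x y
    rw [eval_pencilPoly, prod_ne_zero_iff]
  let n : F → ℕ := fun y => (univ.filter fun x : F => (pencilPoly T x).eval y ≠ 0).card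
  have hne : (pencilHankel T s).det ≠ 0 :=
    det_pencilHankel_ne_zero T y (by simpa only [hiff] using hs)
  -- Powers of distinct linear factors are coprime, so the local divisibilities multiply and the
  -- degree of the determinant bounds the sum of the `s - n y`.
  have hdvd : ∏ y : F, (X - C y) ^ (s - n y) ∣ (pencilHankel T s).det := by
    refine prod_dvd_of_coprime ?_ fun y _ => pow_dvd_det_pencilHankel T s y
    intro a _ b _ hab
    exact (pairwise_coprime_X_sub_C Function.injective_id hab).pow
  have hdeg := natDegree_le_of_dvd hdvd hne
  rw [natDegree_prod_of_monic _ _ fun y _ => (monic_X_sub_C y).pow _] at hdeg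
  simp only [natDegree_pow, natDegree_X_sub_C, mul_one] at hdeg
  have hbound := natDegree_det_pencilHankel_le T s hne
  have hsum : s * Fintype.card F ≤ ∑ y : F, (s - n y) + ∑ y : F, n y := by
    rw [← sum_add_distrib]
    calc s * Fintype.card F = ∑ _y : F, s := by simp [mul_comm]
      _ ≤ _ := sum_le_sum fun y _ => by omega
  have hD : ∑ y : F, n y
      = (univ.filter fun z : F × F => ∀ p ∈ T, 1 + p.1 * z.1 + p.2 * z.2 ≠ 0).card := by
    simp only [n, hiff, card_filter]
    rw [← univ_product_univ, sum_product_right]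
  omega

end PencilPoly

/-! ### Counting skew lines, slope by slope -/

/-- A set `P` of points and a set `L` of lines `(a, b) = {(x, y) | x * a = y + b}` tell all lines
apart, where a line sees a point through incidence and another line through parallelism. -/
def ResolvesLines {F : Type*} [Field F] (P L : Finset (F × F)) : Prop :=
  ∀ l l' : F × F, (∀ p ∈ P, p.1 * l.1 = p.2 + l.2 ↔ p.1 * l'.1 = p.2 + l'.2) →
    (∀ e ∈ L, (e = l ↔ e = l') ∧ (e.1 = l.1 ↔ e.1 = l'.1)) → l = l'

/-- The values which `g` does not take on `P`. -/
def missed {F : Type*} [Fintype F] [DecidableEq F] (P : Finset (F × F)) (g : F × F → F) :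
    Finset F :=
  Finset.univ.filter fun b => ∀ p ∈ P, g p ≠ b

/-- The intercepts of the lines of slope `a` which are disjoint from `P`. -/
def skew {F : Type*} [Field F] [Fintype F] [DecidableEq F] (P : Finset (F × F)) (a : F) :
    Finset F :=
  missed P fun p => p.1 * a - p.2

section Counting

open Finset

lemma mem_missed {F : Type*} [Fintype F] [DecidableEq F] {P : Finset (F × F)}
    {g : F × F → F} {b : F} : b ∈ missed P g ↔ ∀ p ∈ P, g p ≠ b := by
  simp [missed]

lemma sum_card_slope {F : Type*} [Fintype F] [DecidableEq F] (L : Finset (F × F)) :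
    ∑ a : F, (L.filter fun e => e.1 = a).card = L.card :=
  (card_eq_sum_card_fiberwise fun _ _ => mem_coe.2 (mem_univ _)).symm

lemma card_le_card_add_card_missed {F : Type*} [Fintype F] [DecidableEq F]
    (P : Finset (F × F)) (g : F × F → F) :
    Fintype.card F ≤ P.card + (missed P g).card := by
  have hsub : (univ : Finset F) ⊆ P.image g ∪ missed P g := by
    intro b _
    rw [mem_union, mem_image, mem_missed]
    by_cases h : ∃ p ∈ P, g p = b
    · exact Or.inl h
    · exact Or.inr fun p hp hb => h ⟨p, hp, hb⟩
  calc Fintype.card F = (univ : Finset F).card := card_univ.symm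
    _ ≤ _ := card_le_card hsub
    _ ≤ (P.image g).card + (missed P g).card := card_union_le _ _
    _ ≤ _ := by gcongr; exact card_image_le

variable {F : Type*} [Field F] [Fintype F] [DecidableEq F] {P L : Finset (F × F)}

lemma mem_skew {a b : F} : b ∈ skew P a ↔ ∀ p ∈ P, p.1 * a ≠ p.2 + b := by
  simp only [skew, mem_missed, ne_eq, sub_eq_iff_eq_add, add_comm]

/-- Two skew lines of equal slope, both outside L, look alike to all of P and L; hence the single
extra line. -/
lemma ResolvesLines.card_skew_le (h : ResolvesLines P L) (a : F) :
    (skew P a).card ≤ (L.filter fun e => e.1 = a).card + 1 := by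
  rw [← card_filter_add_card_filter_not (s := skew P a) fun b => (a, b) ∈ L]
  refine add_le_add ?_ ?_
  · refine card_le_card_of_injOn (fun b => (a, b)) ?_ ?_
    · intro b hb
      simp only [coe_filter, Set.mem_ofPred_eq] at hb ⊢
      exact ⟨hb.2, trivial⟩
    · intro b _ b' _ hbb
      exact (Prod.mk.inj hbb).2
  · rw [card_le_one]
    intro b hb b' hb'
    rw [mem_filter, mem_skew] at hb hb'
    have := h (a, b) (a, b') (fun p hp => iff_of_false (hb.1 p hp) (hb'.1 p hp))
      (fun e he => ⟨iff_of_false (fun h0 => hb.2 (h0 ▸ he)) (fun h0 => hb'.2 (h0 ▸ he)), Iff.rfl⟩)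
    exact (Prod.mk.inj this).2

lemma ResolvesLines.sum_card_skew_le (h : ResolvesLines P L) :
    ∑ a : F, (skew P a).card ≤ L.card + Fintype.card F := by
  calc ∑ a : F, (skew P a).card ≤ ∑ a : F, ((L.filter fun e => e.1 = a).card + 1) :=
        sum_le_sum fun a _ => h.card_skew_le a
    _ = L.card + Fintype.card F := by rw [sum_add_distrib, sum_card_slope]; simp

lemma ResolvesLines.card_mul_card_le (h : ResolvesLines P L) :
    Fintype.card F * Fintype.card F ≤ Fintype.card F * P.card + L.card + Fintype.card F := by
  calc Fintype.card F * Fintype.card F = ∑ _a : F, Fintype.card F := by simp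
    _ ≤ ∑ a : F, (P.card + (skew P a).card) :=
        sum_le_sum fun a _ => card_le_card_add_card_missed P _
    _ = Fintype.card F * P.card + ∑ a : F, (skew P a).card := by rw [sum_add_distrib]; simp
    _ ≤ _ := by have := h.sum_card_skew_le; omega

/-- Each of the q - 1 other slopes uses up a line of L unless it is missed. -/
lemma card_slope_add_le (L : Finset (F × F)) (a : F) :
    (L.filter fun e => e.1 = a).card + Fintype.card F ≤ L.card + (missed L Prod.fst).card + 1 := by
  have hu : (missed L Prod.fst).card = ∑ a' : F, if a' ∈ missed L Prod.fst then 1 else 0 := by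
    simp
  rw [← sum_card_slope L, hu, ← sum_add_distrib, ← add_sum_erase _ _ (mem_univ a)]
  have hle : ∑ _a' ∈ univ.erase a, 1 ≤ ∑ a' ∈ univ.erase a,
      ((L.filter fun e => e.1 = a').card + if a' ∈ missed L Prod.fst then 1 else 0) := by
    refine sum_le_sum fun a' _ => ?_
    split_ifs with ha
    · omega
    · rw [mem_missed] at ha
      push Not at ha
      obtain ⟨e, he, hea⟩ := ha
      have : 0 < (L.filter fun e => e.1 = a').card := card_pos.2 ⟨e, mem_filter.2 ⟨he, hea⟩⟩
      omega
  have hq : 1 ≤ Fintype.card F := Fintype.card_pos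
  simp only [sum_const, card_erase_of_mem (mem_univ a), card_univ, smul_eq_mul, mul_one] at hle
  omega

/-- Lines whose slope does not occur in L are separated by incidence with P alone. So at most one of
them misses P, and a point of P is the only point of P on at most one of them. All others have at
least two points of P, while each point is on exactly one line per slope. -/
lemma ResolvesLines.two_mul_card_missed_le (h : ResolvesLines P L) :
    2 * ((missed L Prod.fst).card * Fintype.card F)
      ≤ ((missed L Prod.fst).card + 1) * P.card + 2 := by
  set U := missed L Prod.fst with hU
  let n : F × F → ℕ := fun l => (P.filter fun p => p.1 * l.1 = p.2 + l.2).card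
  have hUL : ∀ l ∈ U ×ˢ (univ : Finset F), ∀ e ∈ L, e.1 ≠ l.1 := by
    intro l hl
    exact mem_missed.1 (mem_product.1 hl).1
  have hsep : ∀ l ∈ U ×ˢ (univ : Finset F), ∀ l' ∈ U ×ˢ (univ : Finset F),
      (∀ p ∈ P, p.1 * l.1 = p.2 + l.2 ↔ p.1 * l'.1 = p.2 + l'.2) → l = l' := by
    intro l hl l' hl' hP
    refine h l l' hP fun e he => ?_
    have h1 := hUL l hl e he
    have h2 := hUL l' hl' e he
    exact ⟨iff_of_false (fun h0 => h1 (by rw [h0])) (fun h0 => h2 (by rw [h0])),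
      iff_of_false h1 h2⟩
  have hsum : ∑ l ∈ U ×ˢ (univ : Finset F), n l = U.card * P.card := by
    rw [sum_product]
    have : ∀ a ∈ U, ∑ b : F, n (a, b) = P.card := by
      intro a _
      rw [card_eq_sum_card_fiberwise (f := fun p : F × F => p.1 * a - p.2) (t := univ)
        fun _ _ => mem_coe.2 (mem_univ _)]
      refine sum_congr rfl fun b _ => ?_
      simp only [n, sub_eq_iff_eq_add, add_comm]
    rw [sum_congr rfl this]
    simp
  have h0 : ((U ×ˢ (univ : Finset F)).filter fun l => n l = 0).card ≤ 1 := by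
    rw [card_le_one]
    intro l hl l' hl'
    rw [mem_filter] at hl hl'
    have hl0 := filter_eq_empty_iff.1 (card_eq_zero.1 hl.2)
    have hl0' := filter_eq_empty_iff.1 (card_eq_zero.1 hl'.2)
    exact hsep l hl.1 l' hl'.1 fun p hp => iff_of_false (hl0 hp) (hl0' hp)
  have h1 : ((U ×ˢ (univ : Finset F)).filter fun l => n l = 1).card ≤ P.card := by
    refine card_le_card_of_forall_subsingleton (fun l p => p.1 * l.1 = p.2 + l.2) ?_ ?_
    · intro l hl
      obtain ⟨p, hp⟩ := card_eq_one.1 (mem_filter.1 hl).2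
      have : p ∈ P.filter fun p => p.1 * l.1 = p.2 + l.2 := by rw [hp]; exact mem_singleton_self p
      exact ⟨p, mem_filter.1 this⟩
    · rintro p hp l ⟨hl, hpl⟩ l' ⟨hl', hpl'⟩
      rw [mem_filter] at hl hl'
      have huniq : ∀ l : F × F, n l = 1 → p.1 * l.1 = p.2 + l.2 →
          ∀ r ∈ P, r.1 * l.1 = r.2 + l.2 → r = p := by
        intro l hn hpl r hr hrl
        exact card_le_one.1 hn.le r (mem_filter.2 ⟨hr, hrl⟩) p (mem_filter.2 ⟨hp, hpl⟩)
      refine hsep l hl.1 l' hl'.1 fun r hr => ⟨fun hrl => ?_, fun hrl => ?_⟩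
      · rwa [huniq l hl.2 hpl r hr hrl]
      · rwa [huniq l' hl'.2 hpl' r hr hrl]
  -- Lines with fewer than two points are topped up to weight 2, by 2 if empty and by 1 if tangent.
  have hle : ∑ _l ∈ U ×ˢ (univ : Finset F), 2 ≤ ∑ l ∈ U ×ˢ (univ : Finset F),
      (n l + 2 * (if n l = 0 then 1 else 0) + if n l = 1 then 1 else 0) := by
    refine sum_le_sum fun l _ => ?_
    split_ifs <;> omega
  rw [sum_add_distrib, sum_add_distrib, ← mul_sum, ← card_filter, ← card_filter, hsum, sum_const,
    card_product, card_univ, smul_eq_mul] at hle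
  linarith

/-! ### Skew lines in the dual plane -/

/-- In dual coordinates around the point `p₀`, the lines disjoint from `P` and avoiding `p₀`; the
origin stands for the line at infinity. -/
def dualSkew (P : Finset (F × F)) (p₀ : F × F) : Finset (F × F) :=
  univ.filter fun z => ∀ p ∈ P, 1 + z.1 * (p.1 - p₀.1) + z.2 * (p.2 - p₀.2) ≠ 0

/-- The substitution b = g p₀ + 1/x matches the nonzero x with the missed values; x = 0, the line at
infinity, is the extra one. -/
lemma card_missed_add_one {p₀ : F × F} (hp₀ : p₀ ∈ P) (g : F × F → F) :
    (univ.filter fun x : F => ∀ p ∈ P, 1 + x * (g p₀ - g p) ≠ 0).card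
      = (missed P g).card + 1 := by
  have h0 : (0 : F) ∈ univ.filter fun x : F => ∀ p ∈ P, 1 + x * (g p₀ - g p) ≠ 0 := by simp
  rw [← card_erase_add_one h0]
  congr 1
  refine card_nbij' (fun x => g p₀ + x⁻¹) (fun b => (b - g p₀)⁻¹) ?_ ?_ ?_ ?_
  · intro x hx
    simp only [coe_erase, coe_filter, mem_univ, true_and, Set.mem_sdiff, Set.mem_ofPred_eq,
      Set.mem_singleton_iff] at hx
    rw [mem_coe, mem_missed]
    intro p hp he
    refine hx.1 p hp ?_
    rw [he]
    field_simp [hx.2]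
    ring
  · intro b hb
    rw [mem_coe, mem_missed] at hb
    have hb0 : b - g p₀ ≠ 0 := sub_ne_zero.2 (hb p₀ hp₀).symm
    simp only [coe_erase, coe_filter, mem_univ, true_and, Set.mem_sdiff, Set.mem_ofPred_eq,
      Set.mem_singleton_iff]
    refine ⟨fun p hp he => hb p hp ?_, inv_ne_zero hb0⟩
    field_simp at he
    linear_combination -he
  · intro x _
    simp
  · intro b _
    simp

/-- A linear change of dual coordinates moves the line spanned by v to the axis y = 0, where the
pencil inequality is applied. The factor of p₀ is identically 1 and is dropped; the degree is then
at most |P| - 1, which yields the extra s on the left. -/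
lemma two_mul_card_le_dualSkew {p₀ : F × F} (hp₀ : p₀ ∈ P) (v w : F × F)
    (hvw : v.1 * w.2 - v.2 * w.1 ≠ 0) {s : ℕ}
    (hs : (univ.filter fun x : F =>
      ∀ p ∈ P, 1 + x * (v.1 * (p.1 - p₀.1) + v.2 * (p.2 - p₀.2)) ≠ 0).card = s) :
    2 * (s * Fintype.card F) + s ≤ (dualSkew P p₀).card + s * P.card + s * s := by
  let f : F × F → F × F := fun p =>
    (v.1 * (p.1 - p₀.1) + v.2 * (p.2 - p₀.2), w.1 * (p.1 - p₀.1) + w.2 * (p.2 - p₀.2))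
  have hforall : ∀ x y : F, (∀ r ∈ (P.erase p₀).image f, 1 + r.1 * x + r.2 * y ≠ 0) ↔
      ∀ p ∈ P, 1 + (x * v.1 + y * w.1) * (p.1 - p₀.1) + (x * v.2 + y * w.2) * (p.2 - p₀.2) ≠ 0 := by
    intro x y
    have key : ∀ p : F × F, 1 + (f p).1 * x + (f p).2 * y
        = 1 + (x * v.1 + y * w.1) * (p.1 - p₀.1) + (x * v.2 + y * w.2) * (p.2 - p₀.2) := by
      intro p
      simp only [f]
      ring
    simp only [forall_mem_image, key]
    refine ⟨fun h p hp => ?_, fun h p hp => h p (mem_of_mem_erase hp)⟩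
    by_cases hpp : p = p₀
    · simp [hpp]
    · exact h (mem_erase.2 ⟨hpp, hp⟩)
  have hpencil := card_mul_le_of_pencil ((P.erase p₀).image f) 0 (s := s) (by
    rw [← hs]
    congr 1
    ext x
    simp only [mem_filter, mem_univ, true_and, hforall]
    refine forall₂_congr fun p _ => ?_
    ring_nf)
  have hT : ((P.erase p₀).image f).card ≤ P.card - 1 := by
    rw [← card_erase_of_mem hp₀]
    exact card_image_le
  have hD : (univ.filter fun z : F × F => ∀ r ∈ (P.erase p₀).image f,
      1 + r.1 * z.1 + r.2 * z.2 ≠ 0).card ≤ (dualSkew P p₀).card := by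
    refine card_le_card_of_injOn (fun z => (z.1 * v.1 + z.2 * w.1, z.1 * v.2 + z.2 * w.2)) ?_ ?_
    · intro z hz
      simp only [coe_filter, mem_univ, true_and, Set.mem_ofPred_eq, hforall] at hz
      simpa [dualSkew] using hz
    · rintro ⟨x, y⟩ _ ⟨x', y'⟩ _ h
      obtain ⟨h1, h2⟩ := Prod.mk.inj h
      simp only at h1 h2
      have hx : (x - x') * (v.1 * w.2 - v.2 * w.1) = 0 := by linear_combination w.2 * h1 - w.1 * h2
      have hy : (y - y') * (v.1 * w.2 - v.2 * w.1) = 0 := by linear_combination v.1 * h2 - v.2 * h1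
      rw [sub_eq_zero.1 ((mul_eq_zero.1 hx).resolve_right hvw),
        sub_eq_zero.1 ((mul_eq_zero.1 hy).resolve_right hvw)]
  have hP : 1 ≤ P.card := card_pos.2 ⟨p₀, hp₀⟩
  have hmul : s * ((P.erase p₀).image f).card + s ≤ s * P.card := by
    calc s * ((P.erase p₀).image f).card + s = s * (((P.erase p₀).image f).card + 1) := by ring
      _ ≤ s * P.card := Nat.mul_le_mul_left s (by omega)
  omega

lemma index_slope_le {p₀ : F × F} (hp₀ : p₀ ∈ P) (a : F) {s : ℕ} (hs : (skew P a).card + 1 = s) :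
    2 * (s * Fintype.card F) + s ≤ (dualSkew P p₀).card + s * P.card + s * s := by
  -- The vector (-a, 1) is normal to the lines of slope a, so its multiples are the dual points of
  -- that pencil.
  refine two_mul_card_le_dualSkew hp₀ (-a, 1) (1, 0) (by simp) ?_
  rw [← hs, skew, ← card_missed_add_one hp₀]
  congr 1
  ext x
  simp only [mem_filter, mem_univ, true_and]
  refine forall₂_congr fun p _ => ?_
  ring_nf

lemma card_dualSkew_infinity {p₀ : F × F} (hp₀ : p₀ ∈ P) :
    (univ.filter fun x : F =>
      ∀ p ∈ P, 1 + x * (-1 * (p.1 - p₀.1) + 0 * (p.2 - p₀.2)) ≠ 0).card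
      = (missed P Prod.fst).card + 1 := by
  rw [← card_missed_add_one hp₀]
  congr 1
  ext x
  simp only [mem_filter, mem_univ, true_and]
  refine forall₂_congr fun p _ => ?_
  ring_nf

lemma index_vertical_le {p₀ : F × F} (hp₀ : p₀ ∈ P) {s : ℕ}
    (hs : (missed P Prod.fst).card + 1 = s) :
    2 * (s * Fintype.card F) + s ≤ (dualSkew P p₀).card + s * P.card + s * s :=
  two_mul_card_le_dualSkew hp₀ (-1, 0) (0, 1) (by simp) (by rw [← hs, card_dualSkew_infinity hp₀])

/-- A dual point z with z.2 ≠ 0 is a line of slope -z.1 / z.2. The points with z.2 = 0 are the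
vertical lines and, at the origin, the line at infinity. -/
lemma card_dualSkew_le {p₀ : F × F} (hp₀ : p₀ ∈ P) :
    (dualSkew P p₀).card ≤ (missed P Prod.fst).card + 1 + ∑ a : F, (skew P a).card := by
  rw [← card_filter_add_card_filter_not (s := dualSkew P p₀) fun z => z.2 = 0]
  refine add_le_add ?_ ?_
  · rw [← card_dualSkew_infinity hp₀]
    refine card_le_card_of_injOn (fun z => -z.1) ?_ ?_
    · rintro ⟨x, y⟩ hz
      simp only [dualSkew, coe_filter, mem_filter, mem_univ, true_and, Set.mem_ofPred_eq] at hz ⊢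
      obtain ⟨hz, rfl⟩ := hz
      intro p hp
      convert hz p hp using 1
      ring
    · rintro ⟨x, y⟩ hz ⟨x', y'⟩ hz' h
      simp only [coe_filter, Set.mem_ofPred_eq] at hz hz'
      rw [Prod.mk.injEq, hz.2, hz'.2]
      exact ⟨neg_injective h, rfl⟩
  · rw [← card_sigma]
    refine card_le_card_of_injOn
      (fun z => ⟨-z.1 / z.2, -z.1 / z.2 * p₀.1 - p₀.2 + z.2⁻¹⟩) ?_ ?_
    · rintro ⟨x, y⟩ hz
      simp only [dualSkew, coe_filter, mem_filter, mem_univ, true_and, Set.mem_ofPred_eq] at hz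
      obtain ⟨hz, hy⟩ := hz
      simp only [coe_sigma, Set.mem_sigma_iff, mem_coe, mem_univ, true_and, mem_skew]
      intro p hp h
      refine hz p hp ?_
      field_simp at h
      linear_combination -h
    · rintro ⟨x, y⟩ hz ⟨x', y'⟩ hz' h
      simp only [coe_filter, Set.mem_ofPred_eq] at hz hz'
      simp only [Sigma.mk.injEq, heq_eq_eq] at h
      obtain ⟨h1, h2⟩ := h
      rw [h1] at h2
      have hy : y = y' := inv_injective (by linear_combination h2)
      subst hy
      have hy0 : y ≠ 0 := hz.2
      field_simp at h1
      rw [neg_injective h1]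

end Counting

/-! ### The numerical bound -/

section Bound

open Finset

variable {F : Type*} [Field F] [Fintype F] [DecidableEq F] {P L : Finset (F × F)}

/-- If |P| = q - 2 - d, averaging over the slopes forces |L| ≥ (1 + d)q. Together with the
assumption refuted below, this bound gives q ≥ 8 and so disposes of small fields. -/
lemma ResolvesLines.two_mul_card_le (h : ResolvesLines P L) (h' : ResolvesLines L P) :
    2 * Fintype.card F ≤ P.card + L.card + 2 := by
  have h1 := h.card_mul_card_le
  have h2 := h'.card_mul_card_le
  generalize Fintype.card F = q at *
  by_contra! hlt
  rcases Nat.lt_or_ge (P.card + 1) q with hp | hp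
  · obtain ⟨d, rfl⟩ := Nat.exists_eq_add_of_lt hp
    nlinarith
  · obtain ⟨d, rfl⟩ := Nat.exists_eq_add_of_lt (show L.card + 1 < q by omega)
    nlinarith

/-- If |P| ≤ q - 4, averaging over the slopes forces |L| ≥ 3q, beyond the assumed 8q/3. -/
lemma ResolvesLines.card_le_add_three (h : ResolvesLines P L)
    (hlt : 3 * (P.card + L.card) + 22 ≤ 8 * Fintype.card F) :
    Fintype.card F ≤ P.card + 3 := by
  have h1 := h.card_mul_card_le
  generalize Fintype.card F = q at *
  by_contra! hq
  obtain ⟨d, rfl⟩ := Nat.exists_eq_add_of_lt hq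
  nlinarith

/-- Since |L| ≥ q - 3, the assumption leaves 3|P| ≤ 5q - 13, and then (u + 1)|P| + 2 < 2uq as soon
as u ≥ 5. -/
lemma ResolvesLines.card_missed_le_four (h : ResolvesLines P L) (h' : ResolvesLines L P)
    (hlt : 3 * (P.card + L.card) + 22 ≤ 8 * Fintype.card F) :
    (missed L Prod.fst).card ≤ 4 := by
  have h1 := h.two_mul_card_missed_le
  have h2 := h'.card_le_add_three (by omega)
  generalize Fintype.card F = q at *
  by_contra! hu
  obtain ⟨d, hd⟩ := Nat.exists_eq_add_of_lt hu
  rw [hd] at h1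
  have h3 : 3 * P.card + 13 ≤ 5 * q := by omega
  nlinarith

/-- The expression m(2q - p + 1 - m) is concave in m and equals 4(2q - p - 3) at both m = 4 and m =
2q - p - 3. This value exceeds D, because p ≤ t gives 4p + t ≤ 5(p + t)/2. -/
lemma index_lt_or_gt {q p t w m D : ℕ} (hw : w ≤ 4) (hpt : p ≤ t)
    (hlt : 3 * (p + t) + 22 ≤ 8 * q) (hD : D ≤ w + 1 + (t + q))
    (hm : 2 * (m * q) + m ≤ D + m * p + m * m) :
    m ≤ 3 ∨ 2 * q ≤ m + p + 2 := by
  by_contra! hcon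
  obtain ⟨h1, h2⟩ := hcon
  zify at *
  nlinarith [mul_nonneg (show (0 : ℤ) ≤ m - 4 by linarith)
    (show (0 : ℤ) ≤ 2 * q - p - 3 - m by linarith)]

/-- The indices of the points at infinity with respect to `P`: the numbers of lines through them
disjoint from `P`, the line at infinity included. -/
def indexAtInfinity (P : Finset (F × F)) : Option F → ℕ
  | none => (missed P Prod.fst).card + 1
  | some a => (skew P a).card + 1

lemma two_mul_index_le {p₀ : F × F} (hp₀ : p₀ ∈ P) (o : Option F) :
    2 * (indexAtInfinity P o * Fintype.card F) + indexAtInfinity P o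
      ≤ (dualSkew P p₀).card + indexAtInfinity P o * P.card
        + indexAtInfinity P o * indexAtInfinity P o := by
  cases o with
  | none => exact index_vertical_le hp₀ rfl
  | some a => exact index_slope_le hp₀ a rfl

lemma card_dualSkew_le_of_index_le {p₀ : F × F} (hp₀ : p₀ ∈ P) {m : ℕ}
    (h : ∀ o, indexAtInfinity P o ≤ m + 1) :
    (dualSkew P p₀).card ≤ m + 1 + Fintype.card F * m := by
  refine (card_dualSkew_le hp₀).trans (add_le_add (h none) ?_)
  calc ∑ a : F, (skew P a).card ≤ ∑ _a : F, m :=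
        sum_le_sum fun a _ => Nat.le_of_succ_le_succ (h (some a))
    _ = Fintype.card F * m := by simp

lemma ResolvesLines.index_le_three (h : ResolvesLines P L) (h' : ResolvesLines L P)
    (hpt : P.card ≤ L.card) (hlt : 3 * (P.card + L.card) + 22 ≤ 8 * Fintype.card F)
    {p₀ : F × F} (hp₀ : p₀ ∈ P) (o : Option F) :
    indexAtInfinity P o ≤ 3 := by
  have hu : (missed L Prod.fst).card ≤ 4 := h.card_missed_le_four h' hlt
  have hw : (missed P Prod.fst).card ≤ 4 := h'.card_missed_le_four h (by omega)
  have hq := h.two_mul_card_le h'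
  have hD := (card_dualSkew_le hp₀).trans (Nat.add_le_add_left h.sum_card_skew_le _)
  rcases index_lt_or_gt hw hpt hlt hD (two_mul_index_le hp₀ o) with h3 | h3
  · exact h3
  -- A large vertical index makes p ≥ 2q - 7. A large index at a slope puts at least 2q - p - 4
  -- lines of L into that slope, and at most 4 slopes are missed, so p + t ≥ 3q - 9. Both fail for q
  -- ≥ 8, which follows from `hq` and `hlt`.
  · exfalso
    cases o with
    | none =>
      simp only [indexAtInfinity] at h3
      omega
    | some a =>
      simp only [indexAtInfinity] at h3
      have h4 := h.card_skew_le a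
      have h5 := card_slope_add_le L a
      omega

lemma ResolvesLines.lt_of_card_le (h : ResolvesLines P L) (h' : ResolvesLines L P)
    (hpt : P.card ≤ L.card) :
    8 * Fintype.card F < 3 * (P.card + L.card) + 22 := by
  by_contra! hlt
  have hq := h.two_mul_card_le h'
  have hp := h.card_le_add_three (by omega)
  obtain ⟨p₀, hp₀⟩ : P.Nonempty := card_pos.1 (by omega)
  obtain ⟨o, ho⟩ := Finite.exists_max (indexAtInfinity P)
  have h3 := h.index_le_three h' hpt hlt hp₀ o
  have hidx := two_mul_index_le hp₀ o
  have hpos : 1 ≤ indexAtInfinity P o := by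
    cases o <;> simp [indexAtInfinity]
  obtain ⟨m, hm⟩ := Nat.exists_eq_add_of_le' hpos
  rw [hm] at ho hidx h3
  have hD := card_dualSkew_le_of_index_le hp₀ ho
  have hm2 : m ≤ 2 := by omega
  -- The largest indices 1, 2, 3 give 2q ≤ p + 1, 3q ≤ 2p + 4 and 4q ≤ 3p + 9; the last one is the
  -- source of the constant 8/3.
  interval_cases m <;> omega

theorem ResolvesLines.eight_mul_card_lt (h : ResolvesLines P L) (h' : ResolvesLines L P) :
    8 * Fintype.card F < 3 * (P.card + L.card) + 22 := by
  rcases le_total P.card L.card with hpt | hpt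
  · exact h.lt_of_card_le h' hpt
  · have := h'.lt_of_card_le h hpt
    omega

end Bound

/-! ### Isomorphism invariance of resolving sets -/

section Transport

variable {V W : Type*} {G : SimpleGraph V} {H : SimpleGraph W}

lemma SimpleGraph.Iso.dist_apply (f : G ≃g H) (u v : V) : H.dist (f u) (f v) = G.dist u v := by
  rw [SimpleGraph.dist_eq_sInf, SimpleGraph.dist_eq_sInf]
  congr 1
  ext n
  constructor
  · rintro ⟨w, rfl⟩
    refine ⟨(w.map f.symm.toHom).copy (f.symm_apply_apply u) (f.symm_apply_apply v), ?_⟩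
    rw [SimpleGraph.Walk.length_copy, SimpleGraph.Walk.length_map]
  · rintro ⟨w, rfl⟩
    exact ⟨w.map f.toHom, w.length_map _⟩

lemma IsResolvingSet.map {S : Finset V} (hS : IsResolvingSet G S) (f : G ≃g H) :
    IsResolvingSet H (S.map f.toEquiv.toEmbedding) := by
  intro u v huv
  obtain ⟨u, rfl⟩ := f.surjective u
  obtain ⟨v, rfl⟩ := f.surjective v
  refine congrArg f (hS u v fun s hs => ?_)
  have := huv (f s) (Finset.mem_map_of_mem _ hs)
  rwa [f.dist_apply, f.dist_apply] at this

end Transport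

/-! ### Distances in incidence graphs -/

section IncidenceGraph

variable {A B : Type*} (I : A → B → Prop)

/-- The bipartition fixes the parity of each distance; an explicit walk then leaves few values to
exclude. -/
lemma even_length_incidenceGraph {u v : A ⊕ B} (w : (incidenceGraph I).Walk u v) :
    Even w.length ↔ (u.isLeft ↔ v.isLeft) := by
  let c : (incidenceGraph I).Coloring Bool := SimpleGraph.Coloring.mk Sum.isLeft (by
    rintro (a | b) (a' | b') h
    · exact h.elim
    · simp
    · simp
    · exact h.elim)
  exact c.even_length_iff_congr w

variable {I}

lemma dist_inr_inl_of_not {a a' : A} {b b' : B} (h : ¬ I a b) (h1 : I a' b) (h2 : I a' b')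
    (h3 : I a b') : (incidenceGraph I).dist (Sum.inr b) (Sum.inl a) = 3 := by
  let w : (incidenceGraph I).Walk (Sum.inr b) (Sum.inl a) :=
    .cons (v := Sum.inl a') h1 (.cons (v := Sum.inr b') h2 (.cons (v := Sum.inl a) h3 .nil))
  have hle : (incidenceGraph I).dist (Sum.inr b) (Sum.inl a) ≤ 3 := SimpleGraph.dist_le w
  obtain ⟨w', hw'⟩ := w.reachable.exists_walk_length_eq_dist
  have hpar := even_length_incidenceGraph I w'
  rw [hw'] at hpar
  have hne : (incidenceGraph I).dist (Sum.inr b) (Sum.inl a) ≠ 1 :=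
    fun h0 => h (SimpleGraph.dist_eq_one_iff_adj.1 h0)
  generalize (incidenceGraph I).dist (Sum.inr b) (Sum.inl a) = n at *
  interval_cases n
  · simp at hpar
  · exact absurd rfl hne
  · simp at hpar
  · rfl

lemma dist_inr_inr_of_meet {a : A} {b b' : B} (h : b ≠ b') (h1 : I a b) (h2 : I a b') :
    (incidenceGraph I).dist (Sum.inr b) (Sum.inr b') = 2 := by
  let w : (incidenceGraph I).Walk (Sum.inr b) (Sum.inr b') :=
    .cons (v := Sum.inl a) h1 (.cons (v := Sum.inr b') h2 .nil)
  have hle : (incidenceGraph I).dist (Sum.inr b) (Sum.inr b') ≤ 2 := SimpleGraph.dist_le w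
  have hlt := w.reachable.one_lt_dist_of_ne_of_not_adj (fun h0 => h (Sum.inr_injective h0)) id
  omega

lemma dist_inr_inr_of_not_meet {a a' : A} {b b' c : B} (h : b ≠ b') (hn : ∀ x, I x b → ¬ I x b')
    (h1 : I a b) (h2 : I a c) (h3 : I a' c) (h4 : I a' b') :
    (incidenceGraph I).dist (Sum.inr b) (Sum.inr b') = 4 := by
  let w : (incidenceGraph I).Walk (Sum.inr b) (Sum.inr b') :=
    .cons (v := Sum.inl a) h1 (.cons (v := Sum.inr c) h2
      (.cons (v := Sum.inl a') h3 (.cons (v := Sum.inr b') h4 .nil)))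
  have hle : (incidenceGraph I).dist (Sum.inr b) (Sum.inr b') ≤ 4 := SimpleGraph.dist_le w
  have hlt := w.reachable.one_lt_dist_of_ne_of_not_adj (fun h0 => h (Sum.inr_injective h0)) id
  obtain ⟨w', hw'⟩ := w.reachable.exists_walk_length_eq_dist
  have hpar := even_length_incidenceGraph I w'
  have hne : (incidenceGraph I).dist (Sum.inr b) (Sum.inr b') ≠ 2 := by
    intro h0
    rw [h0] at hw'
    have e1 := w'.adj_getVert_succ (i := 0) (by omega)
    have e2 := w'.adj_getVert_succ (i := 1) (by omega)
    have e3 : w'.getVert (1 + 1) = Sum.inr b' := by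
      rw [show 1 + 1 = w'.length from hw'.symm, w'.getVert_length]
    rw [e3] at e2
    rw [w'.getVert_zero] at e1
    rcases hx : w'.getVert (0 + 1) with x | x
    · rw [hx] at e1
      rw [show (1 : ℕ) = 0 + 1 from rfl, hx] at e2
      exact hn x e1 e2
    · rw [hx] at e1
      exact e1
  rw [hw'] at hpar
  generalize (incidenceGraph I).dist (Sum.inr b) (Sum.inr b') = n at *
  interval_cases n
  · exact absurd rfl hne
  · exact absurd (hpar.2 (by simp)) (by decide)
  · rfl

end IncidenceGraph

/-! ### Self-dual coordinates for the biaffine plane -/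

section Coordinates

variable {F : Type*} [Field F]

/-- Incidence in self-dual coordinates of the biaffine plane. -/
def coordIncidence (p l : F × F) : Prop := p.1 * l.1 = p.2 + l.2

lemma dist_coord_line_point_of_not {p l : F × F} (h : ¬ coordIncidence p l) :
    (incidenceGraph (coordIncidence (F := F))).dist (Sum.inr l) (Sum.inl p) = 3 := by
  -- The line `b'` passes through p with slope l.1 + 1, different from that of l; `a'` is its
  -- intersection with l.
  refine dist_inr_inl_of_not
    (a' := (p.1 * (l.1 + 1) - p.2 - l.2, (p.1 * (l.1 + 1) - p.2 - l.2) * l.1 - l.2))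
    (b' := (l.1 + 1, p.1 * (l.1 + 1) - p.2)) h ?_ ?_ ?_ <;>
  · simp only [coordIncidence]
    ring

lemma dist_coord_lines_of_ne {l e : F × F} (h : e.1 ≠ l.1) :
    (incidenceGraph (coordIncidence (F := F))).dist (Sum.inr l) (Sum.inr e) = 2 := by
  have h0 : e.1 - l.1 ≠ 0 := sub_ne_zero.2 h
  refine dist_inr_inr_of_meet (a := ((e.2 - l.2) / (e.1 - l.1),
    (e.2 - l.2) / (e.1 - l.1) * l.1 - l.2)) (fun he => h (by rw [he])) ?_ ?_
  · simp only [coordIncidence]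
    ring
  · simp only [coordIncidence]
    field_simp
    ring

lemma dist_coord_lines_of_eq {l e : F × F} (h : e.1 = l.1) (hne : e ≠ l) :
    (incidenceGraph (coordIncidence (F := F))).dist (Sum.inr l) (Sum.inr e) = 4 := by
  -- The line `c` is a transversal of slope l.1 + 1, meeting l on the axis x = 0 and the parallel
  -- line e at `a'`.
  refine dist_inr_inr_of_not_meet (a := (0, -l.2)) (c := (l.1 + 1, l.2))
    (a' := (l.2 - e.2, (l.2 - e.2) * l.1 - e.2)) hne.symm ?_ ?_ ?_ ?_ ?_
  · intro x hx hx'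
    simp only [coordIncidence] at hx hx'
    rw [h] at hx'
    exact hne (Prod.ext h (by linear_combination hx - hx'))
  all_goals
    simp only [coordIncidence, h]
    ring

lemma IsResolvingSet.resolvesLines {S : Finset ((F × F) ⊕ (F × F))}
    (hS : IsResolvingSet (incidenceGraph (coordIncidence (F := F))) S) :
    ResolvesLines S.toLeft S.toRight := by
  intro l l' hP hL
  refine Sum.inr_injective (hS (Sum.inr l) (Sum.inr l') ?_)
  rintro (p | e) hs
  · have hiff : coordIncidence p l ↔ coordIncidence p l' := hP p (Finset.mem_toLeft.2 hs)
    by_cases hpl : coordIncidence p l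
    · rw [SimpleGraph.dist_eq_one_iff_adj.2
          (show (incidenceGraph coordIncidence).Adj (Sum.inr l) (Sum.inl p)
          from hpl), SimpleGraph.dist_eq_one_iff_adj.2
          (show (incidenceGraph coordIncidence).Adj (Sum.inr l') (Sum.inl p) from hiff.1 hpl)]
    · rw [dist_coord_line_point_of_not hpl, dist_coord_line_point_of_not (mt hiff.2 hpl)]
  · obtain ⟨heq, hslope⟩ := hL e (Finset.mem_toRight.2 hs)
    by_cases h1 : e = l
    · rw [← h1, ← heq.1 h1]
    · by_cases h2 : e.1 = l.1
      · rw [dist_coord_lines_of_eq h2 h1, dist_coord_lines_of_eq (hslope.1 h2) (mt heq.2 h1)]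
      · rw [dist_coord_lines_of_ne h2, dist_coord_lines_of_ne (mt hslope.2 h2)]

/-- Interchanging points and lines in self-dual coordinates. -/
def coordDuality : incidenceGraph (coordIncidence (F := F)) ≃g
    incidenceGraph (coordIncidence (F := F)) where
  toEquiv := Equiv.sumComm _ _
  map_rel_iff' := by
    rintro (a | b) (a' | b')
    · rfl
    · simp [incidenceGraph, coordIncidence, mul_comm, add_comm]
    · simp [incidenceGraph, coordIncidence, mul_comm, add_comm]
    · rfl

lemma IsResolvingSet.eight_mul_card_lt [Fintype F] {S : Finset ((F × F) ⊕ (F × F))}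
    (hS : IsResolvingSet (incidenceGraph (coordIncidence (F := F))) S) :
    8 * Fintype.card F < 3 * S.card + 22 := by
  classical
  have h' := (hS.map coordDuality).resolvesLines
  have hl : (S.map coordDuality.toEquiv.toEmbedding).toLeft = S.toRight := by
    ext x
    simp [coordDuality]
  have hr : (S.map coordDuality.toEquiv.toEmbedding).toRight = S.toLeft := by
    ext x
    simp [coordDuality]
  rw [hl, hr] at h'
  have := hS.resolvesLines.eight_mul_card_lt h'
  rwa [Finset.card_toLeft_add_card_toRight] at this

open Module Submodule

lemma exists_linearEquiv_apply_eq_vertical {v : F × F} (hv : v ≠ 0) :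
    ∃ e : (F × F) ≃ₗ[F] (F × F), e v = (0, 1) := by
  -- The row (c, d) completes (v.2, -v.1), which annihilates v, to a matrix of determinant 1.
  obtain ⟨c, d, hcd⟩ : ∃ c d : F, c * v.1 + d * v.2 = 1 := by
    by_cases h1 : v.1 = 0
    · have h2 : v.2 ≠ 0 := fun h2 => hv (Prod.ext h1 h2)
      exact ⟨0, v.2⁻¹, by simp [h2]⟩
    · exact ⟨v.1⁻¹, 0, by simp [h1]⟩
  refine ⟨{ toFun := fun p => (v.2 * p.1 - v.1 * p.2, c * p.1 + d * p.2)
            map_add' := fun p r => by ext <;> simp <;> ring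
            map_smul' := fun t p => by ext <;> simp <;> ring
            invFun := fun z => (d * z.1 + v.1 * z.2, -c * z.1 + v.2 * z.2)
            left_inv := fun p => ?_
            right_inv := fun z => ?_ }, ?_⟩
  · ext
    · simp only
      linear_combination p.1 * hcd
    · simp only
      linear_combination p.2 * hcd
  · ext
    · simp only
      linear_combination z.1 * hcd
    · simp only
      linear_combination z.2 * hcd
  · ext
    · simp [mul_comm]
    · simpa using hcd

lemma exists_coordinates (m : AffineLine F) :
    ∃ e : (F × F) ≃ₗ[F] (F × F), ∀ l : AffineLine F,
      ¬ l.1.Parallel m.1 ↔ ∃ a : F, l.1.direction = span F {e.symm (1, a)} := by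
  have hspan : ∀ l : AffineLine F, ∃ v : F × F, v ≠ 0 ∧ l.1.direction = span F {v} := by
    intro l
    obtain ⟨v, hv, hvs⟩ := finrank_eq_one_iff'.1 l.2
    refine ⟨v, fun h => hv (Subtype.ext h), le_antisymm (fun w hw => ?_) ?_⟩
    · obtain ⟨c, hc⟩ := hvs ⟨w, hw⟩
      exact mem_span_singleton.2 ⟨c, congrArg Subtype.val hc⟩
    · exact (span_singleton_le_iff_mem _ _).2 v.2
  have hbot : ∀ l : AffineLine F, l.1 ≠ ⊥ := by
    intro l hl
    have := l.2
    rw [hl, AffineSubspace.direction_bot, finrank_bot] at this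
    exact zero_ne_one this
  obtain ⟨v, hv, hm⟩ := hspan m
  obtain ⟨e, he⟩ := exists_linearEquiv_apply_eq_vertical hv
  refine ⟨e, fun l => ?_⟩
  have hpar : l.1.Parallel m.1 ↔ l.1.direction = span F {v} := by
    rw [AffineSubspace.parallel_iff_direction_eq_and_eq_bot_iff_eq_bot, hm]
    simp [hbot]
  rw [hpar]
  constructor
  · intro h
    obtain ⟨w, hw, hl⟩ := hspan l
    have hw1 : (e w).1 ≠ 0 := by
      intro h0
      apply h
      have hwv : w = (e w).2 • v := by
        apply e.injective
        rw [map_smul, he]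
        ext <;> simp [h0]
      have hc : (e w).2 ≠ 0 := fun hc => hw (by rw [hwv, hc, zero_smul])
      rw [hl, hwv, span_singleton_smul_eq hc.isUnit]
    refine ⟨(e w).2 / (e w).1, ?_⟩
    have hws : e.symm (1, (e w).2 / (e w).1) = (e w).1⁻¹ • w := by
      rw [LinearEquiv.symm_apply_eq, map_smul]
      ext
      · simp [hw1]
      · simp [div_eq_inv_mul]
    rw [hl, hws, span_singleton_smul_eq (inv_ne_zero hw1).isUnit]
  · rintro ⟨a, ha⟩ h
    rw [ha] at h
    have hmem : e.symm (1, a) ∈ span F {v} := h ▸ mem_span_singleton_self _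
    obtain ⟨c, hc⟩ := mem_span_singleton.1 hmem
    have := congrArg (fun z => (e z).1) hc
    simp [he] at this

lemma exists_equiv_biaffineLine (m : AffineLine F) :
    ∃ (e : (F × F) ≃ (F × F)) (f : (F × F) ≃ BiaffineLine m),
      ∀ p l, p ∈ (f l).1.1 ↔ coordIncidence (e p) l := by
  obtain ⟨e, he⟩ := exists_coordinates m
  have hne : ∀ a : F, e.symm (1, a) ≠ 0 := by
    intro a h
    rw [LinearEquiv.map_eq_zero_iff] at h
    exact one_ne_zero (congrArg Prod.fst h)
  -- In the new coordinates the line (a, b) is y = xa - b, which passes through (0, -b) with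
  -- direction (1, a).
  let g : F × F → AffineLine F := fun l =>
    ⟨AffineSubspace.mk' (e.symm (0, -l.2)) (span F {e.symm (1, l.1)}), by
      rw [AffineSubspace.direction_mk', finrank_span_singleton (hne l.1)]⟩
  have hg : ∀ p l, p ∈ (g l).1 ↔ coordIncidence (e p) l := by
    intro p l
    simp only [g, AffineSubspace.mem_mk', mem_span_singleton, vsub_eq_sub, coordIncidence]
    constructor
    · rintro ⟨t, ht⟩
      have h := congrArg e ht
      simp only [map_smul, map_sub, LinearEquiv.apply_symm_apply] at h
      have h1 := congrArg Prod.fst h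
      have h2 := congrArg Prod.snd h
      simp at h1 h2
      rw [← h1, h2]
    · intro h
      refine ⟨(e p).1, e.injective ?_⟩
      simp only [map_smul, map_sub, LinearEquiv.apply_symm_apply]
      ext <;> simp [h]
  let f : F × F → BiaffineLine m := fun l =>
    ⟨g l, (he _).2 ⟨l.1, AffineSubspace.direction_mk' _ _⟩⟩
  have hf : Function.Bijective f := by
    constructor
    · intro l l' h
      have hmem : ∀ z : F × F, coordIncidence z l ↔ coordIncidence z l' := by
        intro z
        have hgl : g l = g l' := congrArg Subtype.val h
        rw [← e.apply_symm_apply z, ← hg, ← hg, hgl]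
      -- The points of a line at abscissae 0 and 1 determine its intercept and slope.
      have h0 := (hmem (0, -l.2)).1 (by simp [coordIncidence])
      have h1 := (hmem (1, l.1 - l.2)).1 (by simp [coordIncidence])
      simp only [coordIncidence] at h0 h1
      exact Prod.ext (by linear_combination h0 - h1) (by linear_combination h0)
    · rintro ⟨l, hl⟩
      obtain ⟨a, ha⟩ := (he l).1 hl
      have hbot : l.1 ≠ ⊥ := by
        intro h0
        rw [h0, AffineSubspace.direction_bot, eq_comm, span_singleton_eq_bot] at ha
        exact hne a ha
      obtain ⟨p, hp⟩ := (AffineSubspace.nonempty_iff_ne_bot l.1).2 hbot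
      refine ⟨(a, (e p).1 * a - (e p).2), Subtype.ext (Subtype.ext ?_)⟩
      have hpg : p ∈ (g (a, (e p).1 * a - (e p).2)).1 := by
        rw [hg]
        simp [coordIncidence]
      have hdir : (g (a, (e p).1 * a - (e p).2)).1.direction = l.1.direction := by
        rw [ha]
        exact AffineSubspace.direction_mk' _ _
      calc (g (a, (e p).1 * a - (e p).2)).1
          = AffineSubspace.mk' p (g (a, (e p).1 * a - (e p).2)).1.direction :=
            (AffineSubspace.mk'_eq hpg).symm
        _ = AffineSubspace.mk' p l.1.direction := by rw [hdir]
        _ = l.1 := AffineSubspace.mk'_eq hp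
  exact ⟨e.toEquiv, Equiv.ofBijective f hf, hg⟩

lemma nonempty_biaffineGraph_iso (m : AffineLine F) :
    Nonempty (biaffineGraph m ≃g incidenceGraph (coordIncidence (F := F))) := by
  obtain ⟨e, f, hef⟩ := exists_equiv_biaffineLine m
  refine ⟨⟨Equiv.sumCongr e f.symm, ?_⟩⟩
  rintro (p | l) (p' | l')
  · rfl
  · obtain ⟨l', rfl⟩ := f.surjective l'
    simpa [biaffineGraph, incidenceGraph] using (hef p l').symm
  · obtain ⟨l, rfl⟩ := f.surjective l
    simpa [biaffineGraph, incidenceGraph] using (hef p' l).symm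
  · rfl

end Coordinates

/-- Connectedness ensures that distance 0 means equality, so the full vertex set is resolving and
the infimum is not the default value of an empty set. -/
lemma exists_isResolvingSet_card_eq_metricDimension {V : Type*} [Finite V] (G : SimpleGraph V)
    (hG : G.Connected) : ∃ S : Finset V, IsResolvingSet G S ∧ S.card = metricDimension G := by
  have := Fintype.ofFinite V
  refine Nat.sInf_mem (s := {n : ℕ | ∃ S : Finset V, IsResolvingSet G S ∧ S.card = n})
    ⟨_, Finset.univ, fun u v h => ?_, rfl⟩
  have := h v (Finset.mem_univ v)
  rw [SimpleGraph.dist_self] at this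
  exact hG.dist_eq_zero_iff.1 this

lemma connected_coordIncidence {F : Type*} [Field F] :
    (incidenceGraph (coordIncidence (F := F))).Connected := by
  have hline : ∀ l : F × F, (incidenceGraph (coordIncidence (F := F))).Reachable
      (Sum.inr 0) (Sum.inr l) := by
    intro l
    by_cases h : l = 0
    · rw [h]
    · by_cases h1 : l.1 = 0
      · exact SimpleGraph.Reachable.of_dist_ne_zero (by
          rw [dist_coord_lines_of_eq (by simpa using h1) h]; norm_num)
      · exact SimpleGraph.Reachable.of_dist_ne_zero (by
          rw [dist_coord_lines_of_ne (by simpa using h1)]; norm_num)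
  refine SimpleGraph.connected_iff_exists_forall_reachable _ |>.2 ⟨Sum.inr 0, ?_⟩
  rintro (p | l)
  · refine (hline (0, -p.2)).trans (SimpleGraph.Adj.reachable ?_)
    change coordIncidence p (0, -p.2)
    simp [coordIncidence]
  · exact hline l

/-- The metric dimension of the Desarguesian biaffine plane of order `q` (over any field with `q`
elements, whichever parallel class is removed) is at least `8q/3 - 7`. -/
theorem mainTheorem5 (F : Type*) [Field F] [Finite F] (m : AffineLine F) :
    8 * (Nat.card F : ℝ) / 3 - 7 ≤ (metricDimension (biaffineGraph m) : ℝ) := by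
  have := Fintype.ofFinite F
  obtain ⟨φ⟩ := nonempty_biaffineGraph_iso m
  have : Finite ((F × F) ⊕ BiaffineLine m) := Finite.of_equiv _ φ.toEquiv.symm
  obtain ⟨S, hS, hcard⟩ := exists_isResolvingSet_card_eq_metricDimension (biaffineGraph m)
    (φ.connected_iff.2 connected_coordIncidence)
  have h := (hS.map φ).eight_mul_card_lt
  rw [Finset.card_map, hcard] at h
  rw [Nat.card_eq_fintype_card]
  -- Strictness between integers gains 1, and 22 - 1 = 3 · 7 gives the constant 7.
  have h' : 8 * (Fintype.card F : ℝ) + 1 ≤ 3 * (metricDimension (biaffineGraph m) : ℝ) + 22 := by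
    exact_mod_cast h
  linarith
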